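/- Conventions. An $n$-manifold is a connected topological space (not assumed Hausdorff) in which every point has an open neighborhood homeomorphic to $\mathbb{R}^n$. For a point $x$ of a space, $NH(x)$ is the set of points $y\neq x$ that cannot be separated from $x$ by disjoint open sets; a space is everywhere non-Hausdorff if $NH(x)\neq\varnothing$ for every $x$. A space is hereditarily separable if each of its subspaces is separable. A subset $U$ of a space is H-maximal if it is open and Hausdorff and is properly contained in no open Hausdorff subset; it is CH-maximal if it is connected, open and Hausdorff and is properly contained in no connected open Hausdorff subset. An open Hausdorff subset $U$ is a sorted neighborhood if there is a continuous map from $\overline{U}$ to a Hausdorff space which is injective on $U$. Kunen line over $\mathbb{R}$. Let $\rho$ be the usual topology of $\mathbb{R}$. A Kunen line over $\mathbb{R}$ consists of an injective enumeration $\mathbb{R}=\{x_\alpha:\alpha<\omega_1\}$ (write $X_\eta=\{x_\beta:\beta<\eta\}$), an enumeration $\{H_\mu:\mu<\omega_1\}$ of all countable subsets of $\mathbb{R}$ with $H_\mu\subset X_\mu$, topologies $\tau_\eta$ on $X_\eta$ for $\eta\le\omega_1$, and countable sets $K_\xi$ for $\xi<\omega_1$, such that for all $\xi<\eta\le\omega_1$: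 (K1) $\tau_\xi=\tau_\eta\cap\mathcal{P}(X_\xi)$; (K2) $\tau_\eta$ is first countable, locally compact and Hausdorff; (K3) $\tau_\eta$ is finer than the topology induced by $\rho$ on $X_\eta$; (K4) for each $\nu\le\xi$, if $x_\xi\in\mathrm{Cl}_\rho(H_\nu)$, then $x_\xi\in\mathrm{Cl}_{\tau_\eta}(H_\nu)$; (K5) $K_\xi\subset X_\eta$ is $\tau_\eta$-compact and $\tau_\eta$-open, and the sets $U\cap K_\xi$, for $U$ a $\rho$-open neighborhood of $x_\xi$, form a $\tau_\eta$-neighborhood base of $x_\xi$. ((K2) and (K3) are also required for $\eta=0$.) Towel-rack manifold of height 2. Let $N$ be a Hausdorff $n$-manifold and $\mathcal{K}_1$ a family of nonempty closed nowhere dense zero-dimensional subsets of $N$, closed under nonempty finite intersections and locally fixed, that is: whenever $x\in K\cap L$ with $K,L\in\mathcal{K}_1$, there is an open $U\ni x$ with $K\cap U=L\cap U$. The towel-rack manifold of height 2 associated to $N,\mathcal{K}_1$ is the set $N\times\{0\}\cup\left(\bigcup\mathcal{K}_1\right)\times\{1\}$, in which neighborhood bases are given by the sets $U\times\{0\}$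 for $\langle x,0\rangle$, where $U\ni x$ is open in $N$, and by the sets $(U-K)\times\{0\}\cup(K\cap U)\times\{1\}$ for $\langle x,1\rangle$, where $U$ is open in $N$, $K\in\mathcal{K}_1$ and $x\in U\cap K$. Statement. Assume the continuum hypothesis. Then there is a hereditarily separable, everywhere non-Hausdorff 1-manifold that has an H-maximal sorted neighborhood. More precisely, there is a Kunen line over $\mathbb{R}$ such that the family $\mathcal{K}_1$ of all nonempty intersections of finitely many (at least one) of the sets $K_\xi$, $\xi<\omega_1$, satisfies the above requirements for $N=\mathbb{R}$, and such that the associated towel-rack manifold $M$ of height 2 is a hereditarily separable, everywhere non-Hausdorff 1-manifold in which $\mathbb{R}\times\{0\}$ is a sorted neighborhood that is both H-maximal and CH-maximal. -/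

import Mathlib

open Set Topology

namespace NHManifold

universe u v

/-! ### Non-Hausdorff spaces and manifolds -/

section General

variable {X : Type u} [TopologicalSpace X]

/-- `x` and `y` are distinct and cannot be separated by disjoint open sets. -/
def Unseparated (x y : X) : Prop :=
  x ≠ y ∧ ¬ ∃ U V : Set X, IsOpen U ∧ IsOpen V ∧ x ∈ U ∧ y ∈ V ∧ Disjoint U V

/-- `NH x` is the set of points which cannot be separated from `x`. -/
def NH (x : X) : Set X := {y | Unseparated x y}

variable (X) in
/-- Everywhere non-Hausdorff spaces. -/
def EverywhereNonHausdorff : Prop := ∀ x : X, (NH x).Nonempty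

variable (X) in
/-- An `n`-manifold (possibly non-Hausdorff): a connected space in which every point has an open
neighborhood homeomorphic to `ℝⁿ`. -/
def IsTopManifold (n : ℕ) : Prop :=
  ConnectedSpace X ∧
    ∀ x : X, ∃ U : Set X, IsOpen U ∧ x ∈ U ∧ Nonempty (U ≃ₜ EuclideanSpace ℝ (Fin n))

variable (X) in
/-- An everywhere non-Hausdorff `n`-manifold. -/
def IsENHManifold (n : ℕ) : Prop := IsTopManifold X n ∧ EverywhereNonHausdorff X

variable (X) in
/-- Every subspace is separable. -/
def HereditarilySeparable : Prop := ∀ A : Set X, TopologicalSpace.SeparableSpace A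

/-- `U` is open, and Hausdorff as a subspace. -/
def IsOpenHausdorff (U : Set X) : Prop := IsOpen U ∧ T2Space U

/-- `U` is open Hausdorff and no open Hausdorff set properly contains it. -/
def IsHMaximal (U : Set X) : Prop :=
  IsOpenHausdorff U ∧ ¬ ∃ V : Set X, IsOpenHausdorff V ∧ U ⊂ V

/-- `U` is connected open Hausdorff and no connected open Hausdorff set properly contains it. -/
def IsCHMaximal (U : Set X) : Prop :=
  (IsConnected U ∧ IsOpenHausdorff U) ∧
    ¬ ∃ V : Set X, (IsConnected V ∧ IsOpenHausdorff V) ∧ U ⊂ V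

/-- `U` is a sorted neighborhood: it is open Hausdorff and there is a continuous map from the
closure of `U` to a Hausdorff space which is injective on `U`. -/
def IsSorted (U : Set X) : Prop :=
  IsOpenHausdorff U ∧
    ∃ (Z : Type u) (_ : TopologicalSpace Z) (_ : T2Space Z) (f : closure U → Z),
      Continuous f ∧ InjOn f {p | (p : X) ∈ U}

end General

/-! ### Towel-rack manifolds -/

section TowelRack

/-- A family of sets is locally fixed if any two members agree near each common point. -/
def LocallyFixed {M : Type u} [TopologicalSpace M] (𝒦 : Set (Set M)) : Prop :=
  ∀ x : M, ∀ K₀ ∈ 𝒦, ∀ K₁ ∈ 𝒦, x ∈ K₀ ∩ K₁ → ∃ U : Set M, IsOpen U ∧ x ∈ U ∧ K₀ ∩ U = K₁ ∩ U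

/-- The nonempty intersections of finitely many (at least one) members of `𝒜`. -/
def finiteIntersections {M : Type u} (𝒜 : Set (Set M)) : Set (Set M) :=
  {K | K.Nonempty ∧ ∃ 𝒮 : Set (Set M), 𝒮.Finite ∧ 𝒮.Nonempty ∧ 𝒮 ⊆ 𝒜 ∧ K = ⋂₀ 𝒮}

/-- The data from which a towel-rack `n`-manifold is built: a Hausdorff `n`-manifold `M`, an index
set `κ` with more than one element (the floors, among which the ground floor `0`), and for each
`α ≠ 0` in `κ` a family `𝒦 α` of subsets of `M`. The value `𝒦 0` is not used. -/
structure IsTowelRackDatum (n : ℕ) {M : Type u} [TopologicalSpace M] {κ : Type v} [Zero κ]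
    (𝒦 : κ → Set (Set M)) : Prop where
  manifold : IsTopManifold M n
  hausdorff : T2Space M
  nontrivial : Nontrivial κ
  locallyFixed : ∀ α, α ≠ 0 → LocallyFixed (𝒦 α)
  inter_mem : ∀ α, α ≠ 0 → ∀ K ∈ 𝒦 α, ∀ L ∈ 𝒦 α, (K ∩ L).Nonempty → K ∩ L ∈ 𝒦 α
  nonempty : ∀ α, α ≠ 0 → ∀ K ∈ 𝒦 α, K.Nonempty
  isClosed : ∀ α, α ≠ 0 → ∀ K ∈ 𝒦 α, IsClosed K
  nowhereDense : ∀ α, α ≠ 0 → ∀ K ∈ 𝒦 α, IsNowhereDense K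
  finite_inter : ∀ α β, α ≠ 0 → β ≠ 0 → α ≠ β → ∀ K ∈ 𝒦 α, ∀ L ∈ 𝒦 β, (K ∩ L).Finite
  zeroDimensional : ∀ α, α ≠ 0 → ∀ K ∈ 𝒦 α,
    TopologicalSpace.IsTopologicalBasis {s : Set K | IsClopen s}

variable {M : Type u} {κ : Type v} [Zero κ]

/-- The underlying set `M × {0} ∪ ⋃_{α ≠ 0} (⋃ 𝒦 α) × {α}` of a towel-rack manifold. -/
def TowelRack (𝒦 : κ → Set (Set M)) : Type (max u v) :=
  {p : M × κ // p.2 = 0 ∨ p.1 ∈ ⋃₀ 𝒦 p.2}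

namespace TowelRack

variable (𝒦 : κ → Set (Set M))

/-- The part of `U × {0}` of the towel rack. -/
def ground (U : Set M) : Set (TowelRack 𝒦) := {p | p.1.2 = 0 ∧ p.1.1 ∈ U}

/-- The set `(U - K) × {0} ∪ (K ∩ U) × {α}`. -/
def lift (α : κ) (U K : Set M) : Set (TowelRack 𝒦) :=
  {p | (p.1.2 = 0 ∧ p.1.1 ∈ U \ K) ∨ (p.1.2 = α ∧ p.1.1 ∈ K ∩ U)}

/-- The topology of the towel rack, generated by the sets `U × {0}` and
`(U - K) × {0} ∪ (K ∩ U) × {α}` for `U` open in `M`, `α ≠ 0` and `K ∈ 𝒦 α`. The lemmas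
`nhds_ground` and `nhds_lift` below show that these sets form neighborhood bases. -/
instance [TopologicalSpace M] : TopologicalSpace (TowelRack 𝒦) :=
  TopologicalSpace.generateFrom
    ({O | ∃ U : Set M, IsOpen U ∧ O = ground 𝒦 U} ∪
      {O | ∃ α : κ, α ≠ 0 ∧ ∃ U K : Set M, IsOpen U ∧ K ∈ 𝒦 α ∧ O = lift 𝒦 α U K})

end TowelRack

end TowelRack

/-! ### Kunen lines -/

section Kunen

variable {X : Type u}

/-- The set `X_η` of the first `η` points of an enumeration. -/
def initialPart (x : Ordinal.{0} → X) (η : Ordinal.{0}) : Set X := x '' Iio η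

/-- `x`, `H`, `τ`, `K` is the outcome of a Kunen line construction over the space `X` (with its
original topology `ρ`, the instance): `x` enumerates `X` injectively in type `ω₁`, `H` enumerates
the countable subsets of `X` in type `ω₁` with `H μ ⊆ X_μ`, `τ η` is a topology on `X_η` for
`η ≤ ω₁`, and `K ξ` is a countable set that is a compact open neighborhood of `x ξ`.
Values at ordinals beyond `ω₁` play no role. The Kunen line is the refinement `τ ω₁` of the
topology of `X = X_{ω₁}`. -/
structure IsKunenLine [TopologicalSpace X] (x : Ordinal.{0} → X) (H : Ordinal.{0} → Set X)
    (τ : (η : Ordinal.{0}) → TopologicalSpace (initialPart x η))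
    (K : Ordinal.{0} → Set X) : Prop where
  bijOn : BijOn x (Iio (Ordinal.omega 1)) univ
  enum_countable : H '' Iio (Ordinal.omega 1) = {A | A.Countable}
  enum_subset : ∀ μ < Ordinal.omega 1, H μ ⊆ initialPart x μ
  /-- `τ ξ = τ η ∩ 𝒫(X_ξ)` -/
  coherent : ∀ ξ η, ξ < η → η ≤ Ordinal.omega 1 → ∀ A : Set X, A ⊆ initialPart x ξ →
    (IsOpen[τ ξ] (Subtype.val ⁻¹' A) ↔ IsOpen[τ η] (Subtype.val ⁻¹' A))
  firstCountable : ∀ η ≤ Ordinal.omega 1, @FirstCountableTopology _ (τ η)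
  locallyCompact : ∀ η ≤ Ordinal.omega 1, @LocallyCompactSpace _ (τ η)
  hausdorff : ∀ η ≤ Ordinal.omega 1, @T2Space _ (τ η)
  /-- `τ η` is finer than the topology induced on `X_η` by that of `X` -/
  finer : ∀ η ≤ Ordinal.omega 1, ∀ U : Set X, IsOpen U → IsOpen[τ η] (Subtype.val ⁻¹' U)
  closure_subset : ∀ ν ξ η, ν ≤ ξ → ξ < η → η ≤ Ordinal.omega 1 → x ξ ∈ closure (H ν) →
    x ξ ∈ Subtype.val '' (@closure _ (τ η) (Subtype.val ⁻¹' (H ν)))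
  countable : ∀ ξ < Ordinal.omega 1, (K ξ).Countable
  subset : ∀ ξ η, ξ < η → η ≤ Ordinal.omega 1 → K ξ ⊆ initialPart x η
  compact : ∀ ξ η, ξ < η → η ≤ Ordinal.omega 1 → @IsCompact _ (τ η) (Subtype.val ⁻¹' (K ξ))
  isOpen : ∀ ξ η, ξ < η → η ≤ Ordinal.omega 1 → IsOpen[τ η] (Subtype.val ⁻¹' (K ξ))
  /-- the traces on `K ξ` of the open neighborhoods of `x ξ` in `X` form a `τ η`-neighborhood base
  of `x ξ` -/
  hasBasis : ∀ ξ η, (h : ξ < η) → η ≤ Ordinal.omega 1 →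
    (@nhds _ (τ η) ⟨x ξ, mem_image_of_mem x h⟩).HasBasis
      (fun U : Set X => IsOpen U ∧ x ξ ∈ U) (fun U => Subtype.val ⁻¹' (U ∩ K ξ))

end Kunen

/-! ### The generating sets of a towel rack form neighborhood bases -/

namespace TowelRack

variable {M : Type u} [TopologicalSpace M] {κ : Type v} [Zero κ] {n : ℕ} {𝒦 : κ → Set (Set M)}

theorem isOpen_ground {U : Set M} (hU : IsOpen U) : IsOpen (ground 𝒦 U) :=
  TopologicalSpace.isOpen_generateFrom_of_mem (Or.inl ⟨U, hU, rfl⟩)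

theorem isOpen_lift {α : κ} (hα : α ≠ 0) {U K : Set M} (hU : IsOpen U) (hK : K ∈ 𝒦 α) :
    IsOpen (lift 𝒦 α U K) :=
  TopologicalSpace.isOpen_generateFrom_of_mem (Or.inr ⟨α, hα, U, K, hU, hK, rfl⟩)

theorem nhds_ground (h : IsTowelRackDatum n 𝒦) (p : TowelRack 𝒦) (hp : p.1.2 = 0) :
    (𝓝 p).HasBasis (fun U : Set M => IsOpen U ∧ p.1.1 ∈ U) (fun U => ground 𝒦 U) := by
  refine ⟨fun t => ⟨fun ht => ?_, fun ⟨U, ⟨hU, hpU⟩, hs⟩ =>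
    Filter.mem_of_superset ((isOpen_ground hU).mem_nhds ⟨hp, hpU⟩) hs⟩⟩
  rw [mem_nhds_iff] at ht
  obtain ⟨O, hOt, hO, hpO⟩ := ht
  suffices H : ∃ U : Set M, (IsOpen U ∧ p.1.1 ∈ U) ∧ ground 𝒦 U ⊆ O by
    obtain ⟨U, hU, hs⟩ := H
    exact ⟨U, hU, hs.trans hOt⟩
  clear hOt
  induction hO with
  | basic s hs =>
    rcases hs with ⟨U, hU, rfl⟩ | ⟨α, hα, U, K, hU, hK, rfl⟩
    · exact ⟨U, ⟨hU, hpO.2⟩, subset_rfl⟩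
    · rcases hpO with h1 | h1
      · exact ⟨U \ K, ⟨hU.sdiff (h.isClosed α hα K hK), h1.2⟩, fun q hq => Or.inl hq⟩
      · exact absurd (h1.1.symm.trans hp) hα
  | univ => exact ⟨univ, ⟨isOpen_univ, trivial⟩, subset_univ _⟩
  | inter s t _ _ ihs iht =>
    obtain ⟨U, hU, hs⟩ := ihs hpO.1
    obtain ⟨V, hV, ht⟩ := iht hpO.2
    exact ⟨U ∩ V, ⟨hU.1.inter hV.1, hU.2, hV.2⟩,
      fun q hq => ⟨hs ⟨hq.1, hq.2.1⟩, ht ⟨hq.1, hq.2.2⟩⟩⟩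
  | sUnion S _ ih =>
    obtain ⟨s, hsS, hps⟩ := hpO
    obtain ⟨U, hU, hs⟩ := ih s hsS hps
    exact ⟨U, hU, hs.trans (subset_sUnion_of_mem hsS)⟩

theorem nhds_lift (h : IsTowelRackDatum n 𝒦) (p : TowelRack 𝒦) (hp : p.1.2 ≠ 0) :
    (𝓝 p).HasBasis (fun UK : Set M × Set M => IsOpen UK.1 ∧ UK.2 ∈ 𝒦 p.1.2 ∧ p.1.1 ∈ UK.1 ∩ UK.2)
      (fun UK => lift 𝒦 p.1.2 UK.1 UK.2) := by
  refine ⟨fun t => ⟨fun ht => ?_, fun ⟨UK, ⟨hU, hK, hpU⟩, hs⟩ =>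
    Filter.mem_of_superset ((isOpen_lift hp hU hK).mem_nhds (Or.inr ⟨rfl, hpU.2, hpU.1⟩)) hs⟩⟩
  rw [mem_nhds_iff] at ht
  obtain ⟨O, hOt, hO, hpO⟩ := ht
  obtain ⟨L, hL, hpL⟩ := p.2.resolve_left hp
  suffices H : ∃ U : Set M, (IsOpen U ∧ p.1.1 ∈ U) ∧ lift 𝒦 p.1.2 U L ⊆ O by
    obtain ⟨U, hU, hs⟩ := H
    exact ⟨(U, L), ⟨hU.1, hL, hU.2, hpL⟩, hs.trans hOt⟩
  clear hOt
  induction hO with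
  | basic s hs =>
    rcases hs with ⟨U, hU, rfl⟩ | ⟨α, hα, U, K, hU, hK, rfl⟩
    · exact absurd hpO.1 hp
    · rcases hpO with h1 | h1
      · exact absurd h1.1 hp
      · obtain ⟨h1, hpK, hpU⟩ := h1
        subst h1
        obtain ⟨W, hW, hpW, he⟩ := h.locallyFixed _ hα p.1.1 K hK L hL ⟨hpK, hpL⟩
        have key : ∀ y ∈ W, (y ∈ K ↔ y ∈ L) := fun y hy =>
          ⟨fun hk => (he ▸ (⟨hk, hy⟩ : y ∈ K ∩ W) : y ∈ L ∩ W).1,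
            fun hk => (he.symm ▸ (⟨hk, hy⟩ : y ∈ L ∩ W) : y ∈ K ∩ W).1⟩
        refine ⟨U ∩ W, ⟨hU.inter hW, hpU, hpW⟩, fun q hq => ?_⟩
        rcases hq with ⟨h0, ⟨hqU, hqW⟩, hqL⟩ | ⟨h1, hqL, hqU, hqW⟩
        · exact Or.inl ⟨h0, hqU, fun hk => hqL ((key _ hqW).1 hk)⟩
        · exact Or.inr ⟨h1, (key _ hqW).2 hqL, hqU⟩
  | univ => exact ⟨univ, ⟨isOpen_univ, trivial⟩, subset_univ _⟩
  | inter s t _ _ ihs iht =>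
    obtain ⟨U, hU, hs⟩ := ihs hpO.1
    obtain ⟨V, hV, ht⟩ := iht hpO.2
    refine ⟨U ∩ V, ⟨hU.1.inter hV.1, hU.2, hV.2⟩, fun q hq => ⟨hs ?_, ht ?_⟩⟩
    · exact hq.imp (fun a => ⟨a.1, a.2.1.1, a.2.2⟩) (fun a => ⟨a.1, a.2.1, a.2.2.1⟩)
    · exact hq.imp (fun a => ⟨a.1, a.2.1.2, a.2.2⟩) (fun a => ⟨a.1, a.2.1, a.2.2.2⟩)
  | sUnion S _ ih =>
    obtain ⟨s, hsS, hps⟩ := hpO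
    obtain ⟨U, hU, hs⟩ := ih s hsS hps
    exact ⟨U, hU, hs.trans (subset_sUnion_of_mem hsS)⟩

end TowelRack

end NHManifold

/-!
The Kunen line is obtained from one refinement of the topology of a metric space `X` of size `ℵ₁`,
generated by sets `K ξ` that are given by a recursion decided entirely in advance. Enumerate `X` as
`x ξ` and its countable subsets as `H ν`, `ξ, ν < ω₁`, with `H ν` among the points of index below
`ν`. For every `ξ` there are at most countably many `H ν`, `ν ≤ ξ`, with `x ξ` in their closure, and
one can pick balls about points `x γ`, `γ < ξ`, that shrink to `x ξ` and whose centers visit each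
such `H ν` arbitrarily close to `x ξ`; radii are chosen so that no point of index below `ξ` lies on
a boundary sphere (`exists_isLadderSystem`). Then `K ξ` consists of `x ξ` and the parts of the sets
`K γ` in these balls. Since the balls are relatively clopen in `K γ`, induction on `ξ` shows that
`K ξ` is compact in the topology generated by the `K ξ` and the open sets of `X`
(`isCompact_ladderSet`), and that the traces on `K ξ` of the neighborhoods of `x ξ` are a
neighborhood base (`nhds_ladderTopology`). The topologies on the initial segments are the subspace
topologies.

Such a line is hereditarily separable if `X` is second countable: a countable dense subset `H ν` of
`A ⊆ X` has all points of `A` of index at least `ν` in its closure for the refined topology.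

Finite intersections of the sets `K ξ` over `ℝ` are countable, compact and open in the refined
topology. Hence they are closed and nowhere dense in `ℝ`, and for two of them, `K` and `L`, the
sets `K \ L` and `L \ K` are compact, and the intersection of their complements is a neighborhood of
each common point on which `K` and `L` agree (`locallyFixed_of_isCompact_preimage`). On the towel rack, the projection
to `ℝ` has continuous sections onto the ground floor and onto the sets
`(ℝ - K) × {0} ∪ K × {1}`, which gives charts. A point of the upper floor cannot be separated from
the point below it because `K` is nowhere dense (`unseparated_groundMap`), whence non-Hausdorffness
everywhere and maximality of the ground floor, which the projection sorts. Both floors are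
continuous images of hereditarily separable spaces, `ℝ` and the Kunen line.
-/

namespace NHManifold

universe u v

open Cardinal Ordinal Filter Metric

/-! ### Enumerations in type `ω₁` -/

theorem countable_Iio_of_lt_omega_one {ξ : Ordinal.{0}} (h : ξ < ω₁) : (Iio ξ).Countable := by
  rw [← Cardinal.le_aleph0_iff_set_countable, Cardinal.mk_Iio_ordinal, Cardinal.lift_le_aleph0]
  rw [← Cardinal.ord_aleph, Cardinal.lt_ord] at h
  simpa using h

theorem countable_Iic_of_lt_omega_one {ξ : Ordinal.{0}} (h : ξ < ω₁) : (Iic ξ).Countable := by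
  rw [← Iio_insert]
  exact (countable_Iio_of_lt_omega_one h).insert ξ

theorem exists_bijOn_omega_one {α : Type} (h : #α = ℵ₁) :
    ∃ f : Ordinal.{0} → α, BijOn f (Iio ω₁) univ := by
  have hc : Cardinal.lift.{0} #(Iio (ω₁ : Ordinal.{0})) = Cardinal.lift.{1} #α := by
    rw [Cardinal.mk_Iio_ordinal, h]
    simp
  obtain ⟨e⟩ := Cardinal.lift_mk_eq'.1 hc
  have : Nonempty α := Cardinal.mk_ne_zero_iff.1 (by rw [h]; exact (Cardinal.aleph_pos 1).ne')
  classical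
  refine ⟨fun o => if ho : o < ω₁ then e ⟨o, ho⟩ else Classical.arbitrary α,
    fun _ _ => mem_univ _, fun a ha b hb hab => ?_, fun y _ => ⟨e.symm y, (e.symm y).2, ?_⟩⟩
  · rw [mem_Iio] at ha hb
    simp only [ha, hb, dif_pos] at hab
    exact congrArg Subtype.val (e.injective hab)
  · have : (e.symm y : Ordinal) < ω₁ := (e.symm y).2
    simp only [this, dif_pos]
    exact e.apply_symm_apply y

theorem exists_subset_initialPart {X : Type} {x : Ordinal.{0} → X}
    (hx : BijOn x (Iio ω₁) univ) {A : Set X} (hA : A.Countable) :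
    ∃ δ < ω₁, A ⊆ initialPart x δ := by
  have := hA.to_subtype
  choose o ho hxo using fun a : A => hx.surjOn (mem_univ (a : X))
  refine ⟨⨆ a, Order.succ (o a),
    Ordinal.iSup_lt_omega_one fun a => (Cardinal.isSuccLimit_omega 1).succ_lt (ho a),
    fun a ha => ⟨o ⟨a, ha⟩, ?_, hxo _⟩⟩
  exact (Order.lt_succ _).trans_le (Ordinal.le_iSup (fun a => Order.succ (o a)) ⟨a, ha⟩)

/-- Under the continuum hypothesis, the countable subsets of a set of size continuum can be
enumerated in type `ω₁` so that the `μ`-th one consists of points with index below `μ`: an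
enumeration repeating each countable set `ℵ₁` times lists it beyond the indices of its points. -/
theorem exists_enum_countable (CH : (continuum : Cardinal.{0}) = ℵ₁) {X : Type} (hX : #X = ℵ₁)
    {x : Ordinal.{0} → X} (hx : BijOn x (Iio ω₁) univ) :
    ∃ H : Ordinal.{0} → Set X, H '' Iio ω₁ = {A | A.Countable} ∧ ∀ μ, H μ ⊆ initialPart x μ := by
  classical
  have hle : #{A : Set X // A.Countable} ≤ ℵ₁ := by
    have h := Cardinal.mk_bounded_set_le X ℵ₀
    rw [hX, max_eq_left (Cardinal.aleph0_le_aleph 1), ← CH, continuum_power_aleph0, CH] at h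
    simpa only [Cardinal.le_aleph0_iff_set_countable] using h
  have : Nonempty {A : Set X // A.Countable} := ⟨⟨∅, countable_empty⟩⟩
  have hcard : #(X × {A : Set X // A.Countable}) = ℵ₁ := by
    rw [Cardinal.mk_prod, Cardinal.lift_id, Cardinal.lift_id, hX]
    exact Cardinal.mul_eq_left (Cardinal.aleph0_le_aleph 1) hle (Cardinal.mk_ne_zero _)
  obtain ⟨g, hg⟩ := exists_bijOn_omega_one hcard
  refine ⟨fun μ => if ((g μ).2 : Set X) ⊆ initialPart x μ then (g μ).2 else ∅, ?_, fun μ => ?_⟩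
  · apply Subset.antisymm
    · rintro _ ⟨μ, -, rfl⟩
      dsimp only
      split_ifs
      exacts [(g μ).2.2, countable_empty]
    · intro A hA
      obtain ⟨δ, hδ, hAδ⟩ := exists_subset_initialPart hx hA
      choose o ho hgo using fun y : X => hg.surjOn (mem_univ (y, (⟨A, hA⟩ : {A : Set X // _})))
      obtain ⟨y, hy⟩ : ∃ y, δ ≤ o y := by
        by_contra! hlt
        have hinj : Function.Injective fun y => (⟨o y, hlt y⟩ : Iio δ) := fun y z hyz => by
          have := congrArg g (congrArg Subtype.val hyz)
          simp only [hgo] at this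
          exact congrArg Prod.fst this
        have := (countable_Iio_of_lt_omega_one hδ).to_subtype
        have hcX := Cardinal.mk_le_aleph0_iff.2 hinj.countable
        rw [hX] at hcX
        exact hcX.not_gt Cardinal.aleph0_lt_aleph_one
      refine ⟨o y, ho y, ?_⟩
      simp only [hgo]
      exact if_pos (hAδ.trans (image_mono (Iio_subset_Iio hy)))
  · dsimp only
    split_ifs with h
    exacts [h, empty_subset _]

/-! ### Ladders and the sets they generate -/

section Ladder

variable {X : Type} [MetricSpace X] {x : Ordinal.{0} → X} {H : Ordinal.{0} → Set X}
  {D : Ordinal.{0} → Set (Ordinal.{0} × ℝ)}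

/-- A ladder system `D` for the enumerations `x` of points and `H` of sets. The member `(γ, r)` of
`D ξ` stands for the ball of radius `r` about the earlier point `x γ`. These balls shrink to `x ξ`,
their boundary spheres miss all points of index below `ξ`, and their centers accumulate at `x ξ`
within each `H ν`, `ν ≤ ξ`, that has `x ξ` in its closure. -/
structure IsLadderSystem (x : Ordinal.{0} → X) (H : Ordinal.{0} → Set X)
    (D : Ordinal.{0} → Set (Ordinal.{0} × ℝ)) : Prop where
  lt : ∀ ξ, ∀ p ∈ D ξ, p.1 < ξ
  radius_pos : ∀ ξ, ∀ p ∈ D ξ, 0 < p.2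
  finite : ∀ ξ, ∀ ε > 0, {p ∈ D ξ | ¬ ball (x p.1) p.2 ⊆ ball (x ξ) ε}.Finite
  sphere : ∀ ξ, ∀ p ∈ D ξ, Disjoint (sphere (x p.1) p.2) (initialPart x ξ)
  accumulates : ∀ ν ξ, ν ≤ ξ → ξ < ω₁ → x ξ ∈ closure (H ν) →
    ∀ ε > 0, ∃ p ∈ D ξ, x p.1 ∈ H ν ∩ ball (x ξ) ε

/-- A ball about `p` whose boundary sphere avoids a given countable set. -/
theorem exists_radius_disjoint_sphere {S : Set X} (hS : S.Countable) (p : X) {δ : ℝ} (hδ : 0 < δ) :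
    ∃ r, 0 < r ∧ r < δ ∧ Disjoint (sphere p r) S := by
  have hd : Dense ((fun y => dist y p) '' S)ᶜ := (hS.image _).dense_compl ℝ
  obtain ⟨r, hr, h0, h1⟩ := hd.exists_between hδ
  exact ⟨r, h0, h1, Set.disjoint_left.2 fun y hy hyS => hr ⟨y, hyS, hy⟩⟩

theorem exists_isLadderSystem (hH : ∀ μ, H μ ⊆ initialPart x μ) :
    ∃ D, IsLadderSystem x H D := by
  classical
  suffices h : ∀ ξ : Ordinal.{0}, ∃ D : Set (Ordinal.{0} × ℝ), (∀ p ∈ D, p.1 < ξ) ∧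
      (∀ p ∈ D, 0 < p.2) ∧
      (∀ ε > 0, {p ∈ D | ¬ ball (x p.1) p.2 ⊆ ball (x ξ) ε}.Finite) ∧
      (∀ p ∈ D, Disjoint (sphere (x p.1) p.2) (initialPart x ξ)) ∧
      (∀ ν, ν ≤ ξ → ξ < ω₁ → x ξ ∈ closure (H ν) →
        ∀ ε > 0, ∃ p ∈ D, x p.1 ∈ H ν ∩ ball (x ξ) ε) by
    choose D h1 h2 h3 h4 h5 using h
    exact ⟨D, h1, h2, h3, h4, fun ν ξ => h5 ξ ν⟩
  intro ξ
  rcases lt_or_ge ξ ω₁ with hξ | hξ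
  swap
  · exact ⟨∅, by simp, by simp, by simp, by simp, fun ν _ h => absurd h hξ.not_gt⟩
  -- the sets to be approached are countably many; `f` numbers them
  have : Countable {ν | ν ≤ ξ ∧ x ξ ∈ closure (H ν)} :=
    ((countable_Iic_of_lt_omega_one hξ).mono fun ν h => h.1).to_subtype
  obtain ⟨f, hf⟩ := exists_injective_nat {ν | ν ≤ ξ ∧ x ξ ∈ closure (H ν)}
  have hpos : ∀ n : ℕ, (0 : ℝ) < 1 / (n + 1) := fun n => Nat.one_div_pos_of_nat
  have key : ∀ (ν : {ν | ν ≤ ξ ∧ x ξ ∈ closure (H ν)}) (n : ℕ), ∃ p : Ordinal.{0} × ℝ, p.1 < ξ ∧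
      0 < p.2 ∧ x p.1 ∈ H ν ∧ ball (x p.1) p.2 ⊆ ball (x ξ) (1 / ((f ν + n : ℕ) + 1)) ∧
      Disjoint (sphere (x p.1) p.2) (initialPart x ξ) := by
    rintro ⟨ν, hν, hcl⟩ n
    obtain ⟨y, hy, hd⟩ := Metric.mem_closure_iff.1 hcl _ (hpos (f ⟨ν, hν, hcl⟩ + n))
    obtain ⟨γ, hγ, rfl⟩ := hH ν hy
    obtain ⟨r, h0, h1, h2⟩ := exists_radius_disjoint_sphere
      (((countable_Iio_of_lt_omega_one hξ).image x : (initialPart x ξ).Countable)) (x γ)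
      (sub_pos.2 hd)
    refine ⟨(γ, r), lt_of_lt_of_le hγ hν, h0, hy, ball_subset_ball' ?_, h2⟩
    rw [dist_comm]
    linarith
  choose g g1 g2 g3 g4 g5 using key
  refine ⟨range fun q : _ × ℕ => g q.1 q.2, ?_, ?_, fun ε hε => ?_, ?_, ?_⟩
  · rintro _ ⟨q, rfl⟩
    exact g1 _ _
  · rintro _ ⟨q, rfl⟩
    exact g2 _ _
  · obtain ⟨N, hN⟩ := exists_nat_one_div_lt hε
    have hfin : {q : {ν | ν ≤ ξ ∧ x ξ ∈ closure (H ν)} × ℕ | f q.1 + q.2 < N}.Finite := by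
      refine Finite.subset (((finite_Iio N).preimage hf.injOn).prod (finite_Iio N))
        fun q hq => ⟨?_, ?_⟩
      · exact lt_of_le_of_lt (Nat.le_add_right _ _) hq
      · exact lt_of_le_of_lt (Nat.le_add_left _ _) hq
    refine (hfin.image fun q => g q.1 q.2).subset ?_
    rintro _ ⟨⟨q, rfl⟩, hq⟩
    refine ⟨q, ?_, rfl⟩
    by_contra! hle
    refine hq ((g4 q.1 q.2).trans (ball_subset_ball (le_trans ?_ hN.le)))
    exact Nat.one_div_le_one_div (not_lt.1 hle)
  · rintro _ ⟨q, rfl⟩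
    exact g5 _ _
  · intro ν hν _ hcl ε hε
    obtain ⟨N, hN⟩ := exists_nat_one_div_lt hε
    refine ⟨_, ⟨(⟨ν, hν, hcl⟩, N), rfl⟩, g3 ⟨ν, hν, hcl⟩ N, ?_⟩
    refine ball_subset_ball (le_trans ?_ hN.le) (g4 ⟨ν, hν, hcl⟩ N (mem_ball_self (g2 _ _)))
    exact Nat.one_div_le_one_div (Nat.le_add_left _ _)

/-- Membership in the set generated by a ladder system at `ξ`, see `ladderSet`. -/
inductive MemLadderSet (x : Ordinal.{0} → X) (D : Ordinal.{0} → Set (Ordinal.{0} × ℝ)) :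
    Ordinal.{0} → X → Prop
  | base (ξ : Ordinal.{0}) : MemLadderSet x D ξ (x ξ)
  | step (ξ : Ordinal.{0}) (p : Ordinal.{0} × ℝ) (y : X) (hp : p ∈ D ξ)
      (h : MemLadderSet x D p.1 y) (hy : y ∈ ball (x p.1) p.2) : MemLadderSet x D ξ y

/-- The set `K ξ` generated by the ladder system `D` at `ξ`: the least solution of
`K ξ = {x ξ} ∪ ⋃_{(γ, r) ∈ D ξ} K γ ∩ ball (x γ) r`. -/
def ladderSet (x : Ordinal.{0} → X) (D : Ordinal.{0} → Set (Ordinal.{0} × ℝ)) (ξ : Ordinal.{0}) :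
    Set X := {y | MemLadderSet x D ξ y}

theorem mem_ladderSet_self (ξ : Ordinal.{0}) : x ξ ∈ ladderSet x D ξ := MemLadderSet.base ξ

theorem ladderSet_eq (ξ : Ordinal.{0}) :
    ladderSet x D ξ = insert (x ξ) (⋃ p ∈ D ξ, ladderSet x D p.1 ∩ ball (x p.1) p.2) := by
  ext y
  simp only [mem_insert_iff, mem_iUnion, exists_prop]
  constructor
  · rintro (_ | ⟨_, p, _, hp, h, hy⟩)
    exacts [Or.inl rfl, Or.inr ⟨p, hp, h, hy⟩]
  · rintro (rfl | ⟨p, hp, h, hy⟩)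
    exacts [MemLadderSet.base ξ, MemLadderSet.step ξ p y hp h hy]

/-- The topology on `X` generated by the original open sets and the sets of a ladder system. -/
@[reducible]
def ladderTopology (x : Ordinal.{0} → X) (D : Ordinal.{0} → Set (Ordinal.{0} × ℝ)) :
    TopologicalSpace X :=
  (inferInstance : TopologicalSpace X) ⊓
    TopologicalSpace.generateFrom (ladderSet x D '' Iio ω₁)

theorem ladderTopology_le :
    ladderTopology x D ≤ (inferInstance : TopologicalSpace X) := inf_le_left

theorem isOpen_ladderSet {ξ : Ordinal.{0}} (hξ : ξ < ω₁) :
    IsOpen[ladderTopology x D] (ladderSet x D ξ) :=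
  (inf_le_right : ladderTopology x D ≤ _) _
    (TopologicalSpace.isOpen_generateFrom_of_mem (mem_image_of_mem _ hξ))

namespace IsLadderSystem

theorem ladderSet_subset (h : IsLadderSystem x H D) (ξ : Ordinal.{0}) :
    ladderSet x D ξ ⊆ x '' Iic ξ := by
  intro y hy
  induction hy with
  | base ξ => exact ⟨ξ, self_mem_Iic, rfl⟩
  | step ξ p y hp _ _ ih =>
    exact image_mono (Iic_subset_Iic.2 (h.lt ξ p hp).le) ih

/-- A ball of the ladder system is relatively clopen in the set it is intersected with. -/
theorem inter_ball_eq_inter_closedBall (h : IsLadderSystem x H D) {ξ : Ordinal.{0}}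
    {p : Ordinal.{0} × ℝ} (hp : p ∈ D ξ) :
    ladderSet x D p.1 ∩ ball (x p.1) p.2 = ladderSet x D p.1 ∩ closedBall (x p.1) p.2 := by
  refine Subset.antisymm (inter_subset_inter_right _ ball_subset_closedBall) fun y hy => ⟨hy.1, ?_⟩
  rw [← closedBall_sdiff_sphere]
  refine ⟨hy.2, fun hs => Set.disjoint_left.1 (h.sphere ξ p hp) hs ?_⟩
  obtain ⟨β, hβ, rfl⟩ := h.ladderSet_subset _ hy.1
  exact mem_image_of_mem x (lt_of_le_of_lt hβ (h.lt ξ p hp))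

/-- Near each of its points `x ξ`, every generated set contains the one generated at `ξ`. -/
theorem ladderSet_mem_nhdsWithin (h : IsLadderSystem x H D) (hx : InjOn x (Iio ω₁))
    {β ξ : Ordinal.{0}} (hβ : β < ω₁) (hξ : ξ < ω₁) (hmem : x ξ ∈ ladderSet x D β) :
    ladderSet x D β ∈ 𝓝[ladderSet x D ξ] (x ξ) := by
  have key : ∀ y, MemLadderSet x D β y → y = x ξ →
      ladderSet x D β ∈ 𝓝[ladderSet x D ξ] (x ξ) := by
    clear hmem
    intro y hy
    induction hy with
    | base β =>
      intro he
      rw [hx hβ hξ he]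
      exact self_mem_nhdsWithin
    | step β p y hp _ hy ih =>
      rintro rfl
      refine mem_of_superset (inter_mem (ih ((h.lt β p hp).trans hβ) rfl)
        (mem_nhdsWithin_of_mem_nhds (isOpen_ball.mem_nhds hy))) fun z hz => ?_
      exact MemLadderSet.step β p z hp hz.1 hz.2
  exact key _ hmem rfl

theorem nhds_ladderTopology (h : IsLadderSystem x H D) (hx : InjOn x (Iio ω₁))
    {ξ : Ordinal.{0}} (hξ : ξ < ω₁) :
    @nhds X (ladderTopology x D) (x ξ) = 𝓝 (x ξ) ⊓ 𝓟 (ladderSet x D ξ) := by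
  rw [ladderTopology, nhds_inf, TopologicalSpace.nhds_generateFrom]
  refine le_antisymm (inf_le_inf_left _ ?_) (le_inf inf_le_left ?_)
  · exact iInf₂_le_of_le _ ⟨mem_ladderSet_self ξ, mem_image_of_mem _ hξ⟩ le_rfl
  · refine le_iInf₂ fun s hs => ?_
    obtain ⟨hs, β, hβ, rfl⟩ := hs
    exact le_principal_iff.2 (h.ladderSet_mem_nhdsWithin hx hβ hξ hs)

/-- All but finitely many of the balls of `D ξ` lie in a given neighborhood of `x ξ`, and the traces
of the others are compact by induction. -/
theorem isCompact_ladderSet (h : IsLadderSystem x H D) (hx : InjOn x (Iio ω₁))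
    {ξ : Ordinal.{0}} (hξ : ξ < ω₁) :
    @IsCompact X (ladderTopology x D) (ladderSet x D ξ) := by
  induction ξ using WellFoundedLT.induction with
  | ind ξ ih =>
    have hC : ∀ p ∈ D ξ, @IsCompact X (ladderTopology x D)
        (ladderSet x D p.1 ∩ ball (x p.1) p.2) := fun p hp => by
      rw [h.inter_ball_eq_inter_closedBall hp]
      exact @IsCompact.inter_right X (ladderTopology x D) _ _
        (ih p.1 (h.lt ξ p hp) ((h.lt ξ p hp).trans hξ))
        (isClosed_closedBall.mono ladderTopology_le)
    rw [@isCompact_iff_ultrafilter_le_nhds X (ladderTopology x D)]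
    intro f hf
    by_cases hex : ∃ p ∈ D ξ, ladderSet x D p.1 ∩ ball (x p.1) p.2 ∈ f
    · obtain ⟨p, hp, hpf⟩ := hex
      obtain ⟨y, hy, hfy⟩ := (@isCompact_iff_ultrafilter_le_nhds X (ladderTopology x D) _).1
        (hC p hp) f (le_principal_iff.2 hpf)
      exact ⟨y, MemLadderSet.step ξ p y hp hy.1 hy.2, hfy⟩
    · push Not at hex
      refine ⟨x ξ, mem_ladderSet_self ξ, ?_⟩
      rw [h.nhds_ladderTopology hx hξ]
      refine le_inf ((nhds_basis_ball.ge_iff).2 fun ε hε => ?_) hf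
      have hfin := h.finite ξ ε hε
      have hnot : (⋃ p ∈ {p ∈ D ξ | ¬ ball (x p.1) p.2 ⊆ ball (x ξ) ε},
          ladderSet x D p.1 ∩ ball (x p.1) p.2) ∉ f := fun hmem => by
        obtain ⟨p, hp, hpf⟩ := (Ultrafilter.finite_biUnion_mem_iff hfin).1 hmem
        exact hex p hp.1 hpf
      refine mem_of_superset (inter_mem (le_principal_iff.1 hf)
        (Ultrafilter.compl_mem_iff_notMem.2 hnot)) fun y hy => ?_
      obtain ⟨hyK, hyn⟩ := hy
      rw [ladderSet_eq] at hyK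
      rcases hyK with rfl | hyK
      · exact mem_ball_self hε
      · simp only [mem_iUnion, exists_prop] at hyK
        obtain ⟨p, hp, hyp⟩ := hyK
        by_contra hyb
        exact hyn (mem_biUnion (x := p) ⟨hp, fun hsub => hyb (hsub hyp.2)⟩ hyp)

theorem mem_closure_ladderTopology (h : IsLadderSystem x H D) (hx : InjOn x (Iio ω₁))
    {ν ξ : Ordinal.{0}} (hνξ : ν ≤ ξ) (hξ : ξ < ω₁) (hcl : x ξ ∈ closure (H ν)) :
    x ξ ∈ @closure X (ladderTopology x D) (H ν) := by
  rw [@mem_closure_iff_nhds X (ladderTopology x D), h.nhds_ladderTopology hx hξ]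
  intro t ht
  obtain ⟨ε, hε, hs⟩ := Metric.mem_nhdsWithin_iff.1 ht
  obtain ⟨p, hp, hpH, hpb⟩ := h.accumulates ν ξ hνξ hξ hcl ε hε
  exact ⟨x p.1, hs ⟨hpb, MemLadderSet.step ξ p _ hp (MemLadderSet.base _)
    (mem_ball_self (h.radius_pos ξ p hp))⟩, hpH⟩

theorem isOpen_initialPart (h : IsLadderSystem x H D) {η : Ordinal.{0}} (hη : η ≤ ω₁) :
    IsOpen[ladderTopology x D] (initialPart x η) := by
  have : initialPart x η = ⋃ ξ ∈ Iio η, ladderSet x D ξ := by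
    refine Subset.antisymm ?_ (iUnion₂_subset fun ξ hξ => ?_)
    · rintro _ ⟨ξ, hξ, rfl⟩
      exact mem_biUnion hξ (mem_ladderSet_self ξ)
    · exact (h.ladderSet_subset ξ).trans (image_mono (Iic_subset_Iio.2 hξ))
  rw [this]
  exact @isOpen_biUnion _ _ (ladderTopology x D) _ _
    fun ξ hξ => isOpen_ladderSet (lt_of_lt_of_le hξ hη)

end IsLadderSystem

end Ladder

/-! ### The Kunen line -/

/-- A single refinement `σ` of the topology of `X`, in which the initial segments are open, makes
`X` a Kunen line: the topologies on the initial segments are those induced by `σ`. -/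
theorem isKunenLine_of_topology {X : Type u} [ρ : TopologicalSpace X] [FirstCountableTopology X]
    [ht : T2Space X] {x : Ordinal.{0} → X} {H K : Ordinal.{0} → Set X} {σ : TopologicalSpace X}
    (hx : BijOn x (Iio ω₁) univ) (hH : H '' Iio ω₁ = {A | A.Countable})
    (hHx : ∀ μ, H μ ⊆ initialPart x μ)
    (hσ : σ ≤ ρ)
    (hpart : ∀ η ≤ ω₁, IsOpen[σ] (initialPart x η))
    (hcl : ∀ ν ξ, ν ≤ ξ → ξ < ω₁ → x ξ ∈ @closure X ρ (H ν) →
      x ξ ∈ @closure X σ (H ν))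
    (hsub : ∀ ξ, K ξ ⊆ x '' Iic ξ)
    (hcomp : ∀ ξ < ω₁, @IsCompact X σ (K ξ)) (hopen : ∀ ξ < ω₁, IsOpen[σ] (K ξ))
    (hself : ∀ ξ, x ξ ∈ K ξ)
    (hnhds : ∀ ξ < ω₁, @nhds X σ (x ξ) = @nhds X ρ (x ξ) ⊓ 𝓟 (K ξ)) :
    @IsKunenLine X ρ x H (fun η => σ.induced (Subtype.val : initialPart x η → X)) K := by
  have hemb : ∀ η ≤ ω₁, @IsOpenEmbedding _ _ (σ.induced (Subtype.val : initialPart x η → X)) σ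
      Subtype.val := fun η hη => @IsOpen.isOpenEmbedding_subtypeVal X σ _ (hpart η hη)
  have hsub' : ∀ ξ η, ξ < η → K ξ ⊆ initialPart x η := fun ξ η h =>
    (hsub ξ).trans (image_mono (Iic_subset_Iio.2 h))
  have ht2 : @T2Space X σ := t2Space_antitone hσ ht
  have hfc : @FirstCountableTopology X σ := by
    refine @FirstCountableTopology.mk X σ fun a => ?_
    obtain ⟨ξ, hξ, rfl⟩ := hx.surjOn (mem_univ a)
    rw [hnhds ξ hξ]
    have : (@nhds X ρ (x ξ)).IsCountablyGenerated :=
      FirstCountableTopology.nhds_generated_countable _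
    infer_instance
  have hlc : @LocallyCompactSpace X σ := by
    let := σ
    have : WeaklyLocallyCompactSpace X := ⟨fun a => by
      obtain ⟨ξ, hξ, rfl⟩ := hx.surjOn (mem_univ a)
      exact ⟨K ξ, hcomp ξ hξ, (hopen ξ hξ).mem_nhds (hself ξ)⟩⟩
    infer_instance
  have himage : ∀ η, ∀ A ⊆ initialPart x η,
      Subtype.val '' (Subtype.val ⁻¹' A : Set (initialPart x η)) = A := fun η A hA => by
    rw [Subtype.image_preimage_coe, inter_eq_right.2 hA]
  have hiff : ∀ η ≤ ω₁, ∀ A ⊆ initialPart x η,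
      (IsOpen[σ.induced (Subtype.val : initialPart x η → X)] (Subtype.val ⁻¹' A) ↔
        IsOpen[σ] A) := fun η hη A hA => by
    rw [@IsOpenEmbedding.isOpen_iff_image_isOpen _ _ _
      (σ.induced (Subtype.val : initialPart x η → X)) σ (hemb η hη), himage η A hA]
  refine @IsKunenLine.mk X ρ x H _ K hx hH (fun μ _ => hHx μ) (fun ξ η hξη hη A hA => ?_)
    (fun η _ => ?_) (fun η hη => ?_) (fun η _ => ?_) (fun η _ U hU => ⟨U, hσ U hU, rfl⟩)
    (fun ν ξ η hνξ hξη hη h => ?_) (fun ξ hξ => ?_) (fun ξ η hξη _ => hsub' ξ η hξη)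
    (fun ξ η hξη hη => ?_) (fun ξ η hξη hη => ?_) (fun ξ η hξη hη => ?_)
  · rw [hiff ξ (hξη.le.trans hη) A hA,
      hiff η hη A (hA.trans (image_mono (Iio_subset_Iio hξη.le)))]
  · exact @TopologicalSpace.firstCountableTopology_induced _ _ σ hfc _
  · exact @IsOpenEmbedding.locallyCompactSpace _ _ (σ.induced _) σ hlc _ (hemb η hη)
  · exact @T2Space.of_injective_continuous _ _ (σ.induced _) σ ht2 _ Subtype.val_injective
      continuous_induced_dom
  · refine ⟨⟨x ξ, mem_image_of_mem x hξη⟩, ?_, rfl⟩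
    rw [@closure_induced _ _ σ, himage η _ ((hHx ν).trans
      (image_mono (Iio_subset_Iio (hνξ.trans hξη.le))))]
    exact hcl ν ξ hνξ (hξη.trans_le hη) h
  · exact ((countable_Iic_of_lt_omega_one hξ).image x).mono (hsub ξ)
  · rw [@IsInducing.isCompact_iff _ _ (σ.induced _) σ _ _ (hemb η hη).isInducing,
      himage η _ (hsub' ξ η hξη)]
    exact hcomp ξ (hξη.trans_le hη)
  · exact (hiff η hη _ (hsub' ξ η hξη)).2 (hopen ξ (hξη.trans_le hη))
  · rw [@nhds_induced _ _ σ]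
    simp only [hnhds ξ (hξη.trans_le hη)]
    exact (((@nhds_basis_opens X ρ (x ξ)).inf_principal (K ξ)).comap
      (Subtype.val : initialPart x η → X)).congr (fun U => and_comm) fun _ _ => rfl

theorem exists_isKunenLine (CH : (continuum : Cardinal.{0}) = ℵ₁) {X : Type} [MetricSpace X]
    (hX : #X = ℵ₁) :
    ∃ (x : Ordinal.{0} → X) (H : Ordinal.{0} → Set X)
      (τ : (η : Ordinal.{0}) → TopologicalSpace (initialPart x η)) (K : Ordinal.{0} → Set X),
      IsKunenLine x H τ K := by
  obtain ⟨x, hx⟩ := exists_bijOn_omega_one hX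
  obtain ⟨H, hH, hHx⟩ := exists_enum_countable CH hX hx
  obtain ⟨D, hD⟩ := exists_isLadderSystem hHx
  exact ⟨x, H, _, ladderSet x D, isKunenLine_of_topology (σ := ladderTopology x D) hx hH hHx
    ladderTopology_le
    (fun η hη => hD.isOpen_initialPart hη)
    (fun ν ξ hνξ hξ h => hD.mem_closure_ladderTopology hx.injOn hνξ hξ h) hD.ladderSet_subset
    (fun ξ hξ => hD.isCompact_ladderSet hx.injOn hξ) (fun ξ hξ => isOpen_ladderSet hξ)
    mem_ladderSet_self (fun ξ hξ => hD.nhds_ladderTopology hx.injOn hξ)⟩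

/-! ### Hereditary separability -/

theorem hereditarilySeparable_iff {X : Type u} [TopologicalSpace X] :
    HereditarilySeparable X ↔ ∀ A : Set X, ∃ t ⊆ A, t.Countable ∧ A ⊆ closure t := by
  refine forall_congr' fun A => ⟨fun h => ?_, fun ⟨t, htA, htc, ht⟩ => ?_⟩
  · obtain ⟨s, hs, hd⟩ := TopologicalSpace.exists_countable_dense A
    exact ⟨Subtype.val '' s, Subtype.coe_image_subset A s, hs.image _, Subtype.dense_iff.1 hd⟩
  · refine ⟨Subtype.val ⁻¹' t, htc.preimage Subtype.val_injective, Subtype.dense_iff.2 ?_⟩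
    rwa [Subtype.image_preimage_coe, inter_eq_right.2 htA]

theorem hereditarilySeparable_of_secondCountable (X : Type u) [TopologicalSpace X]
    [SecondCountableTopology X] : HereditarilySeparable X := fun _ => inferInstance

theorem HereditarilySeparable.exists_countable_of_subset_range {Y : Type u} {Z : Type v}
    [TopologicalSpace Y] [TopologicalSpace Z] (hY : HereditarilySeparable Y) {f : Y → Z}
    (hf : Continuous f) {A : Set Z} (hA : A ⊆ range f) :
    ∃ t ⊆ A, t.Countable ∧ A ⊆ closure t := by
  obtain ⟨t, htA, htc, ht⟩ := hereditarilySeparable_iff.1 hY (f ⁻¹' A)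
  refine ⟨f '' t, image_subset_iff.2 htA, htc.image f, ?_⟩
  calc A = f '' (f ⁻¹' A) := (image_preimage_eq_of_subset hA).symm
    _ ⊆ f '' closure t := image_mono ht
    _ ⊆ closure (f '' t) := image_closure_subset_closure_image hf

/-- Some `H ν` is a countable dense subset of `A` for the topology of `X`. In the refined topology
its closure still contains all points of `A` of index at least `ν`, and the other points of `A` are
countably many. -/
theorem IsKunenLine.hereditarilySeparable {X : Type u} [TopologicalSpace X]
    [SecondCountableTopology X] {x : Ordinal.{0} → X} {H : Ordinal.{0} → Set X}
    {τ : (η : Ordinal.{0}) → TopologicalSpace (initialPart x η)} {K : Ordinal.{0} → Set X}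
    (h : IsKunenLine x H τ K) : @HereditarilySeparable (initialPart x ω₁) (τ ω₁) := by
  rw [@hereditarilySeparable_iff _ (τ ω₁)]
  intro A
  obtain ⟨s, hsA, hsc, hs⟩ := hereditarilySeparable_iff.1
    (hereditarilySeparable_of_secondCountable X) (Subtype.val '' A)
  obtain ⟨ν, hν, rfl⟩ : s ∈ H '' Iio ω₁ := by rwa [h.enum_countable]
  refine ⟨A ∩ Subtype.val ⁻¹' initialPart x ν ∪ Subtype.val ⁻¹' H ν,
    union_subset inter_subset_left fun p hp => ?_, ?_, fun p hp => ?_⟩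
  · obtain ⟨q, hq, hqp⟩ := hsA hp
    rwa [← Subtype.ext hqp]
  · exact ((((countable_Iio_of_lt_omega_one hν).image x).preimage
      Subtype.val_injective).mono inter_subset_right).union (hsc.preimage Subtype.val_injective)
  · obtain ⟨_, ξ, hξ, rfl⟩ := p
    rcases lt_or_ge ξ ν with hlt | hge
    · exact @subset_closure _ (τ ω₁) _ _ (Or.inl ⟨hp, mem_image_of_mem x hlt⟩)
    · obtain ⟨q, hq, hqx⟩ := h.closure_subset ν ξ ω₁ hge hξ le_rfl (hs ⟨_, hp, rfl⟩)
      rw [Subtype.ext (a2 := ⟨x ξ, mem_image_of_mem x hξ⟩) hqx] at hq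
      exact (@closure_mono _ (τ ω₁) (s := _) (t := _) (h := subset_union_right)) hq

/-! ### Towel racks -/

namespace TowelRack

variable {M : Type u} {κ : Type v} [Zero κ] {𝒦 : κ → Set (Set M)}

/-- The projection of a towel rack to its base. -/
def proj (p : TowelRack 𝒦) : M := p.1.1

/-- The embedding of the base onto the ground floor. -/
def groundMap (𝒦 : κ → Set (Set M)) (y : M) : TowelRack 𝒦 := ⟨(y, 0), Or.inl rfl⟩

theorem groundMap_mem_ground (y : M) : groundMap 𝒦 y ∈ ground 𝒦 univ := ⟨rfl, trivial⟩

theorem groundMap_proj {p : TowelRack 𝒦} (hp : p ∈ ground 𝒦 univ) : groundMap 𝒦 (proj p) = p :=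
  Subtype.ext (Prod.ext rfl hp.1.symm)

theorem range_groundMap : range (groundMap 𝒦) = ground 𝒦 univ :=
  Subset.antisymm (range_subset_iff.2 groundMap_mem_ground) fun p hp => ⟨proj p, groundMap_proj hp⟩

open Classical in
/-- The section of the projection that lifts the points of `K` to the floor `α` and leaves the other
points on the ground floor. -/
noncomputable def liftMap {α : κ} {K : Set M} (hK : K ∈ 𝒦 α) (y : M) : TowelRack 𝒦 :=
  if hy : y ∈ K then ⟨(y, α), Or.inr ⟨K, hK, hy⟩⟩ else groundMap 𝒦 y

theorem liftMap_of_mem {α : κ} {K : Set M} (hK : K ∈ 𝒦 α) {y : M} (hy : y ∈ K) :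
    liftMap hK y = ⟨(y, α), Or.inr ⟨K, hK, hy⟩⟩ := dif_pos hy

theorem liftMap_of_notMem {α : κ} {K : Set M} (hK : K ∈ 𝒦 α) {y : M} (hy : y ∉ K) :
    liftMap hK y = groundMap 𝒦 y := dif_neg hy

theorem proj_liftMap {α : κ} {K : Set M} (hK : K ∈ 𝒦 α) (y : M) : proj (liftMap hK y) = y := by
  by_cases hy : y ∈ K
  · rw [liftMap_of_mem hK hy]
    rfl
  · rw [liftMap_of_notMem hK hy]
    rfl

theorem liftMap_mem_lift {α : κ} {K : Set M} (hK : K ∈ 𝒦 α) (y : M) :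
    liftMap hK y ∈ lift 𝒦 α univ K := by
  by_cases hy : y ∈ K
  · rw [liftMap_of_mem hK hy]
    exact Or.inr ⟨rfl, hy, trivial⟩
  · rw [liftMap_of_notMem hK hy]
    exact Or.inl ⟨rfl, trivial, hy⟩

theorem liftMap_proj {α : κ} {K : Set M} (hK : K ∈ 𝒦 α) {p : TowelRack 𝒦}
    (hp : p ∈ lift 𝒦 α univ K) : liftMap hK (proj p) = p := by
  rcases hp with hp | hp
  · rw [liftMap_of_notMem hK (y := proj p) hp.2.2]
    exact groundMap_proj ⟨hp.1, trivial⟩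
  · rw [liftMap_of_mem hK (y := proj p) hp.2.1]
    exact Subtype.ext (Prod.ext rfl hp.1.symm)

variable [TopologicalSpace M] {n : ℕ}

theorem continuous_proj : Continuous (proj : TowelRack 𝒦 → M) := by
  refine continuous_def.2 fun U hU => isOpen_iff_mem_nhds.2 fun p hp => ?_
  by_cases h0 : p.1.2 = 0
  · exact mem_of_superset ((isOpen_ground hU).mem_nhds ⟨h0, hp⟩) fun q hq => hq.2
  · obtain ⟨K, hK, hpK⟩ := p.2.resolve_left h0
    refine mem_of_superset ((isOpen_lift h0 hU hK).mem_nhds (Or.inr ⟨rfl, hpK, hp⟩)) ?_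
    rintro q (hq | hq)
    exacts [hq.2.1, hq.2.2]

theorem continuous_groundMap (h : IsTowelRackDatum n 𝒦) : Continuous (groundMap 𝒦) := by
  refine continuous_generateFrom_iff.2 ?_
  rintro _ (⟨U, hU, rfl⟩ | ⟨α, hα, U, K, hU, hK, rfl⟩)
  · convert hU using 1
    ext y
    simp [groundMap, ground]
  · convert hU.sdiff (h.isClosed α hα K hK) using 1
    ext y
    simp [groundMap, lift, hα.symm]

/-- Continuity at the points of `K` on the floor `α` is where the family has to be locally
fixed. -/
theorem continuous_liftMap (h : IsTowelRackDatum n 𝒦) {α : κ} (hα : α ≠ 0) {K : Set M}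
    (hK : K ∈ 𝒦 α) : Continuous (liftMap hK) := by
  have hKc := h.isClosed α hα K hK
  refine continuous_generateFrom_iff.2 ?_
  rintro _ (⟨U, hU, rfl⟩ | ⟨β, hβ, U, L, hU, hL, rfl⟩)
  · convert hU.sdiff hKc using 1
    ext y
    by_cases hy : y ∈ K
    · simp [liftMap_of_mem hK hy, ground, hy, hα]
    · simp [liftMap_of_notMem hK hy, groundMap, ground, hy]
  · refine isOpen_iff_mem_nhds.2 fun y hy => ?_
    by_cases hyK : y ∈ K
    · rw [mem_preimage, liftMap_of_mem hK hyK] at hy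
      rcases hy with hy | ⟨rfl, hyL, hyU⟩
      · exact absurd hy.1 hα
      obtain ⟨W, hW, hyW, he⟩ := h.locallyFixed α hα y K hK L hL ⟨hyK, hyL⟩
      refine mem_of_superset ((hU.inter hW).mem_nhds ⟨hyU, hyW⟩) fun z hz => ?_
      have hz' : z ∈ K ↔ z ∈ L := by
        have := Set.ext_iff.1 he z
        simpa [hz.2] using this
      by_cases hzK : z ∈ K
      · rw [mem_preimage, liftMap_of_mem hK hzK]
        exact Or.inr ⟨rfl, hz'.1 hzK, hz.1⟩
      · rw [mem_preimage, liftMap_of_notMem hK hzK]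
        exact Or.inl ⟨rfl, hz.1, fun hzL => hzK (hz'.2 hzL)⟩
    · rw [mem_preimage, liftMap_of_notMem hK hyK] at hy
      rcases hy with hy | hy
      swap
      · exact absurd hy.1.symm hβ
      refine mem_of_superset (((hU.sdiff (h.isClosed β hβ L hL)).sdiff hKc).mem_nhds
        ⟨hy.2, hyK⟩) fun z hz => ?_
      rw [mem_preimage, liftMap_of_notMem hK hz.2]
      exact Or.inl ⟨rfl, hz.1⟩

/-- If the projection has a continuous section onto the open set `S`, then every point of `S` has a
chart. -/
theorem exists_chart_of_section (h : IsTowelRackDatum n 𝒦) {S : Set (TowelRack 𝒦)} (hS : IsOpen S)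
    {s : M → TowelRack 𝒦} (hs : Continuous s) (hsS : ∀ y, s y ∈ S) (hps : ∀ y, proj (s y) = y)
    (hsp : ∀ p ∈ S, s (proj p) = p) {p : TowelRack 𝒦} (hp : p ∈ S) :
    ∃ U : Set (TowelRack 𝒦), IsOpen U ∧ p ∈ U ∧ Nonempty (U ≃ₜ EuclideanSpace ℝ (Fin n)) := by
  obtain ⟨U, hU, hpU, ⟨e⟩⟩ := h.manifold.2 (proj p)
  refine ⟨S ∩ proj ⁻¹' U, hS.inter (hU.preimage continuous_proj), ⟨hp, hpU⟩, ⟨?_⟩⟩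
  refine Homeomorph.trans ?_ e
  exact
    { toFun := fun q => ⟨proj q.1, q.2.2⟩
      invFun := fun y => ⟨s y, hsS y, by rw [mem_preimage, hps]; exact y.2⟩
      left_inv := fun q => Subtype.ext (hsp q.1 q.2.1)
      right_inv := fun y => Subtype.ext (hps y)
      continuous_toFun := (continuous_proj.comp continuous_subtype_val).subtype_mk _
      continuous_invFun := (hs.comp continuous_subtype_val).subtype_mk _ }

/-- Since `K` is nowhere dense, every neighborhood of a point on another floor meets every
neighborhood of the point below it on the ground floor. -/
theorem unseparated_groundMap (h : IsTowelRackDatum n 𝒦) {p : TowelRack 𝒦} (hp : p.1.2 ≠ 0) :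
    Unseparated (groundMap 𝒦 (proj p)) p := by
  refine ⟨fun he => hp (by rw [← he]; rfl), ?_⟩
  rintro ⟨U, V, hU, hV, hgU, hpV, hUV⟩
  obtain ⟨U', ⟨hU', hpU'⟩, hsU⟩ :=
    (nhds_ground h (groundMap 𝒦 (proj p)) rfl).mem_iff.1 (hU.mem_nhds hgU)
  obtain ⟨⟨V', K⟩, ⟨hV', hK, hpV', -⟩, hsV⟩ := (nhds_lift h p hp).mem_iff.1 (hV.mem_nhds hpV)
  have hnd : interior K = ∅ := by
    have := h.nowhereDense _ hp K hK
    rwa [IsNowhereDense, (h.isClosed _ hp K hK).closure_eq] at this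
  obtain ⟨y, hy, hyK⟩ : ∃ y ∈ U' ∩ V', y ∉ K := by
    by_contra! hsub
    have : proj p ∈ interior K := mem_interior.2 ⟨U' ∩ V', hsub, hU'.inter hV', hpU', hpV'⟩
    rw [hnd] at this
    exact this
  exact Set.disjoint_left.1 hUV (hsU (a := groundMap 𝒦 y) ⟨rfl, hy.1⟩)
    (hsV (Or.inl ⟨rfl, hy.2, hyK⟩))

theorem denseRange_groundMap (h : IsTowelRackDatum n 𝒦) : DenseRange (groundMap 𝒦) := by
  intro p
  by_cases hp : p.1.2 = 0
  · rw [← groundMap_proj ⟨hp, trivial⟩]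
    exact subset_closure (mem_range_self _)
  · refine mem_closure_iff.2 fun V hV hpV => ?_
    by_contra hne
    exact (unseparated_groundMap h hp).2 ⟨ground 𝒦 univ, V, isOpen_ground isOpen_univ, hV,
      groundMap_mem_ground _, hpV, by
        rw [← range_groundMap, disjoint_comm, disjoint_iff_inter_eq_empty]
        exact not_nonempty_iff_eq_empty.1 hne⟩

theorem isTopManifold (h : IsTowelRackDatum n 𝒦) : IsTopManifold (TowelRack 𝒦) n := by
  have := h.manifold.1
  refine ⟨{ (denseRange_groundMap h).preconnectedSpace (continuous_groundMap h) with
    toNonempty := this.toNonempty.map (groundMap 𝒦) }, fun p => ?_⟩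
  by_cases hp : p.1.2 = 0
  · exact exists_chart_of_section h (isOpen_ground isOpen_univ) (continuous_groundMap h)
      groundMap_mem_ground (fun _ => rfl) (fun _ => groundMap_proj) ⟨hp, trivial⟩
  · obtain ⟨K, hK, hpK⟩ := p.2.resolve_left hp
    exact exists_chart_of_section h (isOpen_lift hp isOpen_univ hK) (continuous_liftMap h hp hK)
      (liftMap_mem_lift hK) (proj_liftMap hK) (fun _ => liftMap_proj hK)
      (Or.inr ⟨rfl, hpK, trivial⟩)

theorem isENHManifold (h : IsTowelRackDatum n 𝒦) (hcover : ∀ y : M, ∃ α ≠ 0, y ∈ ⋃₀ 𝒦 α) :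
    IsENHManifold (TowelRack 𝒦) n := by
  refine ⟨isTopManifold h, fun p => ?_⟩
  by_cases hp : p.1.2 = 0
  · obtain ⟨α, hα, hpα⟩ := hcover (proj p)
    refine ⟨⟨(proj p, α), Or.inr hpα⟩, ?_⟩
    have := unseparated_groundMap h (p := ⟨(proj p, α), Or.inr hpα⟩) hα
    rwa [show groundMap 𝒦 (proj ⟨(proj p, α), Or.inr hpα⟩) = p from
      groundMap_proj ⟨hp, trivial⟩] at this
  · refine ⟨groundMap 𝒦 (proj p), (unseparated_groundMap h hp).1.symm, ?_⟩
    rintro ⟨U, V, hU, hV, hpU, hgV, hUV⟩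
    exact (unseparated_groundMap h hp).2 ⟨V, U, hV, hU, hgV, hpU, hUV.symm⟩

theorem isOpenHausdorff_ground (h : IsTowelRackDatum n 𝒦) :
    IsOpenHausdorff (ground 𝒦 univ) := by
  have := h.hausdorff
  refine ⟨isOpen_ground isOpen_univ, T2Space.of_injective_continuous (f := fun p => proj p.1)
    (fun p q hpq => Subtype.ext ?_) (continuous_proj.comp continuous_subtype_val)⟩
  rw [← groundMap_proj p.2, ← groundMap_proj q.2]
  exact congrArg _ hpq

theorem isHMaximal_ground (h : IsTowelRackDatum n 𝒦) : IsHMaximal (ground 𝒦 univ) := by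
  refine ⟨isOpenHausdorff_ground h, ?_⟩
  rintro ⟨V, ⟨hV, hT2⟩, hsub, hne⟩
  obtain ⟨p, hpV, hpg⟩ := not_subset.1 hne
  have hp : p.1.2 ≠ 0 := fun hp => hpg ⟨hp, trivial⟩
  have hun := unseparated_groundMap h hp
  obtain ⟨A, B, hA, hB, hgA, hpB, hAB⟩ := hT2.t2 (show
    (⟨groundMap 𝒦 (proj p), hsub (groundMap_mem_ground _)⟩ : V) ≠ ⟨p, hpV⟩ from
    fun he => hun.1 (congrArg Subtype.val he))
  exact hun.2 ⟨Subtype.val '' A, Subtype.val '' B, hV.isOpenMap_subtype_val A hA,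
    hV.isOpenMap_subtype_val B hB, ⟨_, hgA, rfl⟩, ⟨_, hpB, rfl⟩,
    (disjoint_image_iff Subtype.val_injective).2 hAB⟩

theorem isCHMaximal_ground (h : IsTowelRackDatum n 𝒦) : IsCHMaximal (ground 𝒦 univ) := by
  have := h.manifold.1
  refine ⟨⟨?_, isOpenHausdorff_ground h⟩,
    fun ⟨V, hV, hlt⟩ => (isHMaximal_ground h).2 ⟨V, hV.2, hlt⟩⟩
  rw [← range_groundMap]
  exact isConnected_range (continuous_groundMap h)

/-- The projection sorts the ground floor. -/
theorem isSorted_ground {κ : Type} [Zero κ] {𝒦 : κ → Set (Set M)} (h : IsTowelRackDatum n 𝒦) :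
    IsSorted (ground 𝒦 univ) := by
  refine ⟨isOpenHausdorff_ground h, M, inferInstance, h.hausdorff, fun p => proj p.1,
    continuous_proj.comp continuous_subtype_val, fun p hp q hq hpq => Subtype.ext ?_⟩
  rw [← groundMap_proj hp, ← groundMap_proj hq]
  exact congrArg _ hpq

/-- The ground floor and the upper floor are continuous images of `M` and of its refinement `Y`. -/
theorem hereditarilySeparable {𝒦 : Fin 2 → Set (Set M)} (h : IsTowelRackDatum n 𝒦)
    (hM : HereditarilySeparable M) {Y : Type v} [TopologicalSpace Y] (hY : HereditarilySeparable Y)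
    {e : Y → M} (he : Continuous e) (hsurj : Function.Surjective e)
    (hopen : ∀ K ∈ 𝒦 1, IsOpen (e ⁻¹' K)) (hcover : ⋃₀ 𝒦 1 = Set.univ) :
    HereditarilySeparable (TowelRack 𝒦) := by
  let f : Y → TowelRack 𝒦 := fun y => ⟨(e y, 1), Or.inr (hcover ▸ mem_univ (e y))⟩
  have hf : Continuous f := by
    refine continuous_generateFrom_iff.2 ?_
    rintro _ (⟨U, hU, rfl⟩ | ⟨β, hβ, U, L, hU, hL, rfl⟩)
    · have : f ⁻¹' ground 𝒦 U = ∅ :=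
        eq_empty_of_forall_notMem fun y hy => (one_ne_zero : (1 : Fin 2) ≠ 0) hy.1
      rw [this]
      exact isOpen_empty
    · obtain rfl : β = 1 := Fin.eq_one_of_ne_zero β hβ
      have : f ⁻¹' lift 𝒦 1 U L = e ⁻¹' L ∩ e ⁻¹' U :=
        Subset.antisymm (fun y hy => hy.elim (fun hy => absurd hy.1 hβ) fun hy => hy.2)
          fun y hy => Or.inr ⟨rfl, hy⟩
      rw [this]
      exact (hopen L hL).inter (hU.preimage he)
  rw [hereditarilySeparable_iff]
  intro A
  obtain ⟨t, htA, htc, ht⟩ := hM.exists_countable_of_subset_range (continuous_groundMap h)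
    (A := A ∩ range (groundMap 𝒦)) inter_subset_right
  obtain ⟨s, hsA, hsc, hs⟩ := hY.exists_countable_of_subset_range hf
    (A := A ∩ range f) inter_subset_right
  refine ⟨t ∪ s, union_subset (htA.trans inter_subset_left) (hsA.trans inter_subset_left),
    htc.union hsc, fun p hp => ?_⟩
  rw [closure_union]
  by_cases h0 : p.1.2 = 0
  · exact Or.inl (ht ⟨hp, _, groundMap_proj ⟨h0, trivial⟩⟩)
  · obtain ⟨y, hy⟩ := hsurj (proj p)
    exact Or.inr (hs ⟨hp, y, Subtype.ext (Prod.ext hy (Fin.eq_one_of_ne_zero _ h0).symm)⟩)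

end TowelRack

/-! ### Towel racks over Kunen lines -/

/-- If `K` is compact and `L` open for a finer topology, here presented by a continuous surjection
`e : Y → X`, then `K \ L` is compact. -/
theorem isClosed_sdiff_of_isCompact_preimage {X : Type u} {Y : Type v} [TopologicalSpace X]
    [T2Space X] [TopologicalSpace Y] {e : Y → X} (he : Continuous e)
    (hsurj : Function.Surjective e) {K L : Set X} (hK : IsCompact (e ⁻¹' K))
    (hL : IsOpen (e ⁻¹' L)) : IsClosed (K \ L) := by
  rw [← image_preimage_eq (K \ L) hsurj, preimage_sdiff]
  exact ((hK.diff hL).image he).isClosed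

theorem locallyFixed_of_isCompact_preimage {X : Type u} {Y : Type v} [TopologicalSpace X]
    [T2Space X] [TopologicalSpace Y] {e : Y → X} (he : Continuous e)
    (hsurj : Function.Surjective e) {𝒜 : Set (Set X)} (hcomp : ∀ K ∈ 𝒜, IsCompact (e ⁻¹' K))
    (hopen : ∀ K ∈ 𝒜, IsOpen (e ⁻¹' K)) : LocallyFixed 𝒜 := by
  intro y K hK L hL hy
  have hKL := isClosed_sdiff_of_isCompact_preimage he hsurj (hcomp K hK) (hopen L hL)
  have hLK := isClosed_sdiff_of_isCompact_preimage he hsurj (hcomp L hL) (hopen K hK)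
  refine ⟨(K \ L)ᶜ ∩ (L \ K)ᶜ, hKL.isOpen_compl.inter hLK.isOpen_compl,
    ⟨fun h => h.2 hy.2, fun h => h.2 hy.1⟩, ?_⟩
  ext z
  simp only [mem_inter_iff, mem_compl_iff, Set.mem_sdiff]
  tauto

theorem inter_mem_finiteIntersections {X : Type u} {𝒜 : Set (Set X)} {K L : Set X}
    (hK : K ∈ finiteIntersections 𝒜) (hL : L ∈ finiteIntersections 𝒜) (h : (K ∩ L).Nonempty) :
    K ∩ L ∈ finiteIntersections 𝒜 := by
  obtain ⟨-, 𝒮, h𝒮, hne, hsub, rfl⟩ := hK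
  obtain ⟨-, 𝒯, h𝒯, -, hsub', rfl⟩ := hL
  exact ⟨h, 𝒮 ∪ 𝒯, h𝒮.union h𝒯, hne.inl, union_subset hsub hsub', (sInter_union 𝒮 𝒯).symm⟩

theorem mem_finiteIntersections {X : Type u} {𝒜 : Set (Set X)} {K : Set X} (hK : K ∈ 𝒜)
    (h : K.Nonempty) : K ∈ finiteIntersections 𝒜 :=
  ⟨h, {K}, finite_singleton K, singleton_nonempty K, singleton_subset_iff.2 hK,
    (sInter_singleton K).symm⟩

theorem isTopologicalBasis_isClopen_of_countable_of_isCompact {X : Type u} [MetricSpace X]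
    {K : Set X} (hc : K.Countable) (hK : IsCompact K) :
    TopologicalSpace.IsTopologicalBasis {s : Set K | IsClopen s} := by
  have := isCompact_iff_compactSpace.1 hK
  have : TotallyDisconnectedSpace K :=
    totallyDisconnectedSpace_subtype_iff.2 hc.isTotallyDisconnected
  exact loc_compact_Haus_tot_disc_of_zero_dim

theorem isTopManifold_real : IsTopManifold ℝ 1 :=
  ⟨inferInstance, fun _ => ⟨univ, isOpen_univ, trivial,
    ⟨(Homeomorph.Set.univ ℝ).trans ((Homeomorph.funUnique (Fin 1) ℝ).symm.trans
      (EuclideanSpace.equiv (Fin 1) ℝ).symm.toHomeomorph)⟩⟩⟩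

/-- A countable closed set of reals has empty interior. -/
theorem isNowhereDense_of_countable_of_isClosed {K : Set ℝ} (hc : K.Countable) (hK : IsClosed K) :
    IsNowhereDense K := by
  rw [IsNowhereDense, hK.closure_eq, interior_eq_empty_iff_dense_compl]
  exact hc.dense_compl ℝ

variable {x : Ordinal.{0} → ℝ} {H : Ordinal.{0} → Set ℝ}
  {τ : (η : Ordinal.{0}) → TopologicalSpace (initialPart x η)} {K : Ordinal.{0} → Set ℝ}

namespace IsKunenLine

theorem continuous_val (h : IsKunenLine x H τ K) :
    @Continuous (initialPart x ω₁) ℝ (τ ω₁) _ Subtype.val :=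
  @Continuous.mk _ _ (τ ω₁) _ _ fun U hU => h.finer ω₁ le_rfl U hU

theorem surjective_val (h : IsKunenLine x H τ K) :
    Function.Surjective (Subtype.val : initialPart x ω₁ → ℝ) := fun y =>
  ⟨⟨y, h.bijOn.surjOn (mem_univ y)⟩, rfl⟩

theorem mem_self (h : IsKunenLine x H τ K) {ξ : Ordinal.{0}} (hξ : ξ < ω₁) : x ξ ∈ K ξ :=
  have := (h.hasBasis ξ ω₁ hξ le_rfl).mem_of_mem ⟨isOpen_univ, trivial⟩
  (@mem_of_mem_nhds _ (τ ω₁) _ _ this).2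

theorem countable_of_mem (h : IsKunenLine x H τ K) {L : Set ℝ}
    (hL : L ∈ finiteIntersections (K '' Iio ω₁)) : L.Countable := by
  obtain ⟨-, 𝒮, -, ⟨S, hS⟩, hsub, rfl⟩ := hL
  obtain ⟨ξ, hξ, rfl⟩ := hsub hS
  exact (h.countable ξ hξ).mono (sInter_subset_of_mem hS)

theorem isOpen_of_mem (h : IsKunenLine x H τ K) {L : Set ℝ}
    (hL : L ∈ finiteIntersections (K '' Iio ω₁)) :
    IsOpen[τ ω₁] (Subtype.val ⁻¹' L : Set (initialPart x ω₁)) := by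
  obtain ⟨-, 𝒮, hfin, -, hsub, rfl⟩ := hL
  rw [preimage_sInter]
  refine @Set.Finite.isOpen_biInter _ _ (τ ω₁) _ _ hfin fun S hS => ?_
  obtain ⟨ξ, hξ, rfl⟩ := hsub hS
  exact h.isOpen ξ ω₁ hξ le_rfl

theorem isCompact_of_mem (h : IsKunenLine x H τ K) {L : Set ℝ}
    (hL : L ∈ finiteIntersections (K '' Iio ω₁)) :
    @IsCompact _ (τ ω₁) (Subtype.val ⁻¹' L : Set (initialPart x ω₁)) := by
  obtain ⟨-, 𝒮, -, ⟨S, hS⟩, hsub, rfl⟩ := hL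
  have hcomp : ∀ S ∈ 𝒮, @IsCompact _ (τ ω₁) (Subtype.val ⁻¹' S : Set (initialPart x ω₁)) :=
    fun S hS => by
      obtain ⟨ξ, hξ, rfl⟩ := hsub hS
      exact h.compact ξ ω₁ hξ le_rfl
  have := h.hausdorff ω₁ le_rfl
  refine @IsCompact.of_isClosed_subset _ (τ ω₁) _ _ (hcomp S hS) ?_
    (preimage_mono (sInter_subset_of_mem hS))
  rw [preimage_sInter]
  exact @isClosed_biInter _ _ (τ ω₁) _ _ fun S hS =>
    @IsCompact.isClosed _ (τ ω₁) this _ (hcomp S hS)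

theorem isTowelRackDatum (h : IsKunenLine x H τ K) :
    IsTowelRackDatum 1 fun _ : Fin 2 => finiteIntersections (K '' Iio ω₁) := by
  have hcomp : ∀ L ∈ finiteIntersections (K '' Iio ω₁), IsCompact L := fun L hL => by
    rw [← image_preimage_eq L h.surjective_val]
    exact @IsCompact.image _ _ (τ ω₁) _ _ _ (h.isCompact_of_mem hL) h.continuous_val
  exact
    { manifold := isTopManifold_real
      hausdorff := inferInstance
      nontrivial := inferInstance
      locallyFixed := fun _ _ => @locallyFixed_of_isCompact_preimage _ _ _ _ (τ ω₁) _
        h.continuous_val h.surjective_val _ (fun _ => h.isCompact_of_mem)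
        fun _ => h.isOpen_of_mem
      inter_mem := fun _ _ _ hK _ hL => inter_mem_finiteIntersections hK hL
      nonempty := fun _ _ _ hK => hK.1
      isClosed := fun _ _ L hL => (hcomp L hL).isClosed
      nowhereDense := fun _ _ L hL =>
        isNowhereDense_of_countable_of_isClosed (h.countable_of_mem hL) (hcomp L hL).isClosed
      finite_inter := fun α β hα hβ hαβ => absurd
        ((Fin.eq_one_of_ne_zero α hα).trans (Fin.eq_one_of_ne_zero β hβ).symm) hαβ
      zeroDimensional := fun _ _ L hL =>
        isTopologicalBasis_isClopen_of_countable_of_isCompact (h.countable_of_mem hL)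
          (hcomp L hL) }

theorem sUnion_finiteIntersections (h : IsKunenLine x H τ K) :
    ⋃₀ finiteIntersections (K '' Iio ω₁) = Set.univ := by
  refine eq_univ_of_forall fun y => ?_
  obtain ⟨ξ, hξ, rfl⟩ := h.bijOn.surjOn (mem_univ y)
  exact ⟨K ξ, mem_finiteIntersections (mem_image_of_mem K hξ) ⟨_, h.mem_self hξ⟩, h.mem_self hξ⟩

end IsKunenLine

end NHManifold

theorem mainTheorem5 (CH : (Cardinal.continuum : Cardinal.{0}) = Cardinal.aleph 1) :
    ∃ (x : Ordinal.{0} → ℝ) (H : Ordinal.{0} → Set ℝ)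
      (τ : (η : Ordinal.{0}) → TopologicalSpace (NHManifold.initialPart x η))
      (K : Ordinal.{0} → Set ℝ) (𝒦 : Fin 2 → Set (Set ℝ)),
      NHManifold.IsKunenLine x H τ K ∧
      𝒦 1 = NHManifold.finiteIntersections (K '' Set.Iio (Ordinal.omega 1)) ∧
      NHManifold.IsTowelRackDatum 1 𝒦 ∧
      NHManifold.IsENHManifold (NHManifold.TowelRack 𝒦) 1 ∧
      NHManifold.HereditarilySeparable (NHManifold.TowelRack 𝒦) ∧
      NHManifold.IsHMaximal (NHManifold.TowelRack.ground 𝒦 Set.univ) ∧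
      NHManifold.IsCHMaximal (NHManifold.TowelRack.ground 𝒦 Set.univ) ∧
      NHManifold.IsSorted (NHManifold.TowelRack.ground 𝒦 Set.univ) := by
  obtain ⟨x, H, τ, K, h⟩ := NHManifold.exists_isKunenLine CH (Cardinal.mk_real.trans CH)
  have hd := h.isTowelRackDatum
  exact ⟨x, H, τ, K, _, h, rfl, hd,
    NHManifold.TowelRack.isENHManifold hd fun y =>
      ⟨1, one_ne_zero, h.sUnion_finiteIntersections ▸ Set.mem_univ y⟩,
    @NHManifold.TowelRack.hereditarilySeparable _ _ _ _ hd
      (NHManifold.hereditarilySeparable_of_secondCountable ℝ) _ (τ _) h.hereditarilySeparable _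
      h.continuous_val h.surjective_val (fun _ => h.isOpen_of_mem) h.sUnion_finiteIntersections,
    NHManifold.TowelRack.isHMaximal_ground hd, NHManifold.TowelRack.isCHMaximal_ground hd,
    NHManifold.TowelRack.isSorted_ground hd⟩
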